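/- **Theorem 1.1.** Let $S_3\subset\mathbb{E}^3$ be a tetrahedron, i.e. the convex hull of four affinely independent points (for instance a regular one). A lattice $\Lambda\subset\mathbb{E}^3$ is the set of integer linear combinations of three linearly independent vectors, and its determinant $d(\Lambda)$ is the absolute value of the determinant of the matrix with these vectors as rows. If $S_3+\Lambda$ is a lattice covering of $\mathbb{E}^3$, i.e. $\bigcup_{v\in\Lambda}(S_3+v)=\mathbb{E}^3$, then its density satisfies $$\theta(S_3,\Lambda)=\frac{\operatorname{vol}(S_3)}{d(\Lambda)}\ \ge\ \frac{25}{18}.$$ In other words, the lattice covering density $\theta^l(S_3)=\inf_{\Lambda}\theta(S_3,\Lambda)$, the infimum being over the (non-empty) family of all lattices $\Lambda$ such that $S_3+\Lambda$ is a lattice covering of $\mathbb{E}^3$, satisfies $$\theta^l(S_3)\ge\frac{25}{18}.$$ -/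

import Mathlib

open MeasureTheory

/-- `K + Λ` is a lattice covering of `𝔼ⁿ`: the translates `K + v`, `v ∈ Λ`, have union `𝔼ⁿ`. -/
def IsLatticeCovering {n : ℕ} (K : Set (EuclideanSpace ℝ (Fin n)))
    (Λ : Submodule ℤ (EuclideanSpace ℝ (Fin n))) : Prop :=
  (⋃ v ∈ Λ, (fun x => x + v) '' K) = Set.univ

/-- The density `θ(K, Λ) = vol(K) / d(Λ)`; the determinant `d(Λ)` of the lattice is the volume of a
fundamental domain (the absolute value of the determinant of a basis). -/
noncomputable def coveringDensity {n : ℕ} (K : Set (EuclideanSpace ℝ (Fin n)))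
    (Λ : Submodule ℤ (EuclideanSpace ℝ (Fin n))) : ℝ :=
  volume.real K / ZLattice.covolume Λ

/-- The set of densities of all lattice coverings of `𝔼ⁿ` by `K`, where `Λ` runs over all
full-dimensional lattices. -/
def latticeCoveringDensities {n : ℕ} (K : Set (EuclideanSpace ℝ (Fin n))) : Set ℝ :=
  {θ | ∃ (Λ : Submodule ℤ (EuclideanSpace ℝ (Fin n))) (_ : DiscreteTopology Λ),
    IsZLattice ℝ Λ ∧ IsLatticeCovering K Λ ∧ θ = coveringDensity K Λ}

/-- The lattice covering density `θˡ(K)`: the density of the thinnest lattice covering of `𝔼ⁿ`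
by `K`, as an infimum. The convention `sInf ∅ = 0` makes a positive lower bound for it include the
existence of lattice coverings. -/
noncomputable def latticeCoveringDensity {n : ℕ} (K : Set (EuclideanSpace ℝ (Fin n))) : ℝ :=
  sInf (latticeCoveringDensities K)

/-!
In affine coordinates the tetrahedron is the corner simplex `S = {z ≥ 0, ∑ zᵢ ≤ 1}` of volume
`1 / 6`, and `Λ` becomes a lattice `L`. Order `ℝ³` by coordinate sum, with lexicographic ties, and
let `B = reducedPoints L` consist of the points of `S` that are smallest in their class modulo `L`
within `S`. Since `S + L` is everything, so is `B + L` (`exists_sub_mem_reducedPoints`); hence a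
fundamental domain has at most the volume of `B`, and the bound `25 / 18 = (1 / 6) / (3 / 25)`
follows from `volume B ≤ 3 / 25` (`volume_reducedPoints_le`).

A point `z ∈ S` is missing from `B` exactly when some positive `v ∈ L` satisfies `v ≤ z`
coordinatewise. Pushing facet points outwards shows that every point `x` of the facet `∑ xᵢ = 1`
dominates a lattice vector with positive coordinate sum (`exists_le_of_mem_facet`). If that vector
`v` has a coordinate `vᵢ ≤ 0`, then `B` misses the whole column over `x` in direction `i`.
Otherwise `v` has positive coordinates and lies in `S`. Let `u` be the smallest such lattice vector;
if `x` does not dominate `u`, say `xᵢ < uᵢ`, then `v - u` is positive, lies below `x`, and its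
`i`-th coordinate is negative, so again `B` misses a column over `x` (`exists_centre`). When `x`
does dominate `u`, at least the points `z ≥ u` are missing from `B`. If no such `u` exists, a vertex
of the facet serves as `u`, up to a null set.

Every point of `S` lies on a column over the facet in the direction of its smallest coordinate, so
`volume B` is at most the integral over the facet of the lengths of these three columns, cut at the
smallest coordinate of the facet point. At most two columns count where `x` does not dominate `u`,
and at most three where it does. So
`volume B + volume (S ∩ {z ≥ u}) ≤ 2 * volume (facetPrism 0) + volume (facetPrism u)`
(`volume_add_le_of_forall_column`). With `s = 1 - ∑ uᵢ`, this reads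
`volume B ≤ 1 / 9 + s ^ 2 / 6 - 5 * s ^ 3 / 18`, which is at most `3 / 25`, with equality for
`s = 2 / 5`.
-/

/-! ### A lexicographic order on `ℝ³` -/

/-- Positivity for the translation-invariant total order on `ℝ³` that compares coordinate sums
first and breaks ties lexicographically by the first two coordinates. -/
def LexPos (v : Fin 3 → ℝ) : Prop :=
  0 < v 0 + v 1 + v 2 ∨ (v 0 + v 1 + v 2 = 0 ∧ (0 < v 0 ∨ (v 0 = 0 ∧ 0 < v 1)))

/-- The key realising the order whose positive elements are given by `LexPos`. -/
def lexKey (v : Fin 3 → ℝ) : ℝ ×ₗ ℝ ×ₗ ℝ :=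
  toLex (v 0 + v 1 + v 2, toLex (v 0, v 1))

theorem lexKey_lt_iff (x y : Fin 3 → ℝ) : lexKey x < lexKey y ↔ LexPos (y - x) := by
  simp only [lexKey, LexPos, Prod.Lex.lt_iff, ofLex_toLex, Pi.sub_apply]
  constructor
  · rintro (h | ⟨h, h | ⟨h', h''⟩⟩)
    · left; linarith
    · right; exact ⟨by linarith, Or.inl (by linarith)⟩
    · right; exact ⟨by linarith, Or.inr ⟨by linarith, by linarith⟩⟩
  · rintro (h | ⟨h, h | ⟨h', h''⟩⟩)
    · left; linarith
    · right; exact ⟨by linarith, Or.inl (by linarith)⟩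
    · right; exact ⟨by linarith, Or.inr ⟨by linarith, by linarith⟩⟩

theorem lexPos_sub_of_lexKey_le {x y : Fin 3 → ℝ} (h : lexKey x ≤ lexKey y) (hne : x ≠ y) :
    LexPos (y - x) := by
  rw [← lexKey_lt_iff]
  refine lt_of_le_of_ne h fun he => hne ?_
  simp only [lexKey, EmbeddingLike.apply_eq_iff_eq, Prod.mk.injEq] at he
  obtain ⟨h1, h2, h3⟩ := he
  ext i; fin_cases i
  · exact h2
  · exact h3
  · simp only [Fin.reduceFinMk]; linarith

/-! ### Lattice translates of the corner simplex -/

/-- The corner simplex of `ℝ³`: the convex hull of the origin and the standard basis vectors. -/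
def cornerSimplex : Set (Fin 3 → ℝ) :=
  {z | (∀ i, 0 ≤ z i) ∧ z 0 + z 1 + z 2 ≤ 1}

/-- The points of the corner simplex that no `LexPos` lattice vector lies below. Every class modulo
the lattice that meets the simplex has its lexicographically smallest point there. -/
def reducedPoints (L : AddSubgroup (Fin 3 → ℝ)) : Set (Fin 3 → ℝ) :=
  {z ∈ cornerSimplex | ∀ v ∈ L, LexPos v → ¬ v ≤ z}

section Combinatorics

variable {L : AddSubgroup (Fin 3 → ℝ)}

theorem exists_sub_mem_reducedPoints
    (hfin : ∀ R : ℝ, {v | v ∈ L ∧ ∀ i, |v i| ≤ R}.Finite)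
    (hcov : ∀ x, ∃ v ∈ L, x - v ∈ cornerSimplex) (x : Fin 3 → ℝ) :
    ∃ v ∈ L, x - v ∈ reducedPoints L := by
  have hf : {v | v ∈ L ∧ x - v ∈ cornerSimplex}.Finite := by
    refine (hfin (|x 0| + |x 1| + |x 2| + 1)).subset ?_
    rintro v ⟨hv, h0, h1⟩
    refine ⟨hv, fun i => ?_⟩
    have a0 := h0 0
    have a1 := h0 1
    have a2 := h0 2
    simp only [Pi.sub_apply] at a0 a1 a2 h1
    have := abs_nonneg (x 0)
    have := abs_nonneg (x 1)
    have := abs_nonneg (x 2)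
    have := le_abs_self (x 0)
    have := le_abs_self (x 1)
    have := le_abs_self (x 2)
    have := neg_abs_le (x 0)
    have := neg_abs_le (x 1)
    have := neg_abs_le (x 2)
    rw [abs_le]
    fin_cases i <;> constructor <;> simp <;> linarith
  obtain ⟨v, hv, hmin⟩ := Set.exists_min_image _ (fun v => lexKey (x - v)) hf (hcov x)
  refine ⟨v, hv.1, hv.2, fun w hw hpos hle => ?_⟩
  have hsum : 0 ≤ w 0 + w 1 + w 2 := by
    rcases hpos with h | h
    · exact h.le
    · exact h.1.ge
  have hm := hmin (v + w) ⟨L.add_mem hv.1 hw, fun i => ?_, ?_⟩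
  · refine absurd hm (not_le.2 ((lexKey_lt_iff _ _).2 ?_))
    convert hpos using 1
    abel
  · have := hle i
    simp only [Pi.sub_apply, Pi.add_apply] at this ⊢
    linarith
  · have := hv.2.2
    simp only [Pi.sub_apply, Pi.add_apply] at this ⊢
    linarith

/-- The facet `∑ xᵢ = 1` of the simplex is covered by translates that reach strictly beyond it. -/
theorem exists_le_of_mem_facet
    (hfin : ∀ R : ℝ, {v | v ∈ L ∧ ∀ i, |v i| ≤ R}.Finite)
    (hcov : ∀ x, ∃ v ∈ L, x - v ∈ cornerSimplex) {x : Fin 3 → ℝ} (hx : ∀ i, 0 ≤ x i)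
    (hx1 : x 0 + x 1 + x 2 = 1) :
    ∃ v ∈ L, 0 < v 0 + v 1 + v 2 ∧ v ≤ x := by
  -- Push `x` outwards by `1 / (n + 1)`; one lattice vector serves infinitely many `n`.
  set ε : ℕ → ℝ := fun n => 1 / ((n : ℝ) + 1) with hε
  have hε0 : ∀ n, 0 < ε n := fun n => Nat.one_div_pos_of_nat
  have hε1 : ∀ n, ε n ≤ 1 := fun n => by
    rw [hε]; simp only
    rw [div_le_one (by positivity)]
    have : (0 : ℝ) ≤ n := by positivity
    linarith
  choose f hf hfx using fun n => hcov (fun i => x i + ε n)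
  have hpos : ∀ n, 0 < f n 0 + f n 1 + f n 2 := by
    intro n
    have := (hfx n).2
    simp only [Pi.sub_apply] at this
    have := hε0 n
    linarith
  have hle : ∀ n i, f n i ≤ x i + ε n := by
    intro n i
    have := (hfx n).1 i
    simp only [Pi.sub_apply] at this
    linarith
  have hxle : ∀ i, x i ≤ 1 := by
    intro i
    have := hx 0
    have := hx 1
    have := hx 2
    fin_cases i <;> simp <;> linarith
  have hbd : ∀ n, f n ∈ {v | v ∈ L ∧ ∀ i, |v i| ≤ 4} := by
    intro n
    have a := fun i => (hle n i).trans (add_le_add (hxle i) (hε1 n))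
    have a0 := a 0
    have a1 := a 1
    have a2 := a 2
    have := hpos n
    refine ⟨hf n, fun i => abs_le.2 ?_⟩
    fin_cases i <;> constructor <;> simp <;> linarith
  have hrange : (Set.range f).Finite := (hfin 4).subset (Set.range_subset_iff.2 hbd)
  have : Finite (Set.range f) := hrange
  obtain ⟨⟨v, m, hm⟩, hv⟩ := Finite.exists_infinite_fiber (Set.rangeFactorization f)
  have hinf : (Set.rangeFactorization f ⁻¹' {⟨v, m, hm⟩}).Infinite := Set.infinite_coe_iff.1 hv
  refine ⟨v, hm ▸ hf m, hm ▸ hpos m, fun i => ?_⟩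
  refine le_of_forall_pos_le_add fun δ hδ => ?_
  obtain ⟨N, hN⟩ := exists_nat_one_div_lt hδ
  obtain ⟨n, hn, hNn⟩ := hinf.exists_gt N
  have hfn : f n = v := congrArg Subtype.val (Set.mem_singleton_iff.1 hn)
  have h1 : ε n ≤ 1 / ((N : ℝ) + 1) := by
    rw [hε]; simp only
    apply one_div_le_one_div_of_le (by positivity)
    have : (N : ℝ) ≤ n := by exact_mod_cast hNn.le
    linarith
  have := hle n i
  rw [hfn] at this
  linarith

/-- The centre of the facet: at every facet point `x` that does not dominate `u`, some lattice
vector below `x` has a nonpositive coordinate, hence stays below the whole column from `x` to the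
corresponding coordinate plane. The null set accounts for the degenerate case of no centre. -/
theorem exists_centre
    (hfin : ∀ R : ℝ, {v | v ∈ L ∧ ∀ i, |v i| ≤ R}.Finite)
    (hcov : ∀ x, ∃ v ∈ L, x - v ∈ cornerSimplex) :
    ∃ u : Fin 3 → ℝ, (∀ i, 0 ≤ u i) ∧ u 0 + u 1 + u 2 ≤ 1 ∧
      volume (reducedPoints L ∩ Set.Ici u) = 0 ∧
      ∀ x : Fin 3 → ℝ, (∀ i, 0 ≤ x i) → x 0 + x 1 + x 2 = 1 →
        u ≤ x ∨ ∃ i, ∃ v ∈ L, LexPos v ∧ v ≤ x ∧ v i ≤ 0 := by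
  set U : Set (Fin 3 → ℝ) := {v | v ∈ L ∧ (∀ i, 0 < v i) ∧ v 0 + v 1 + v 2 ≤ 1} with hU
  have hUfin : U.Finite := by
    refine (hfin 1).subset ?_
    rintro v ⟨hv, h0, h1⟩
    have a0 := h0 0
    have a1 := h0 1
    have a2 := h0 2
    refine ⟨hv, fun i => abs_le.2 ?_⟩
    fin_cases i <;> constructor <;> simp <;> linarith
  rcases U.eq_empty_or_nonempty with hE | hne
  · refine ⟨![1, 0, 0], ?_, by simp, ?_, ?_⟩
    · intro i; fin_cases i <;> simp
    · refine measure_mono_null (t := {![1, 0, 0]}) ?_ (measure_singleton _)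
      rintro z ⟨⟨⟨h0, h1⟩, -⟩, hz⟩
      have a0 := hz 0
      have a1 := h0 1
      have a2 := h0 2
      simp only [Matrix.cons_val_zero] at a0
      rw [Set.mem_singleton_iff]
      ext i; fin_cases i <;> simp <;> linarith
    · intro x hx hx1
      obtain ⟨v, hv, hv0, hvx⟩ := exists_le_of_mem_facet hfin hcov hx hx1
      by_cases h : ∃ i, v i ≤ 0
      · obtain ⟨i, hi⟩ := h
        exact Or.inr ⟨i, v, hv, Or.inl hv0, hvx, hi⟩
      · push Not at h
        have : v ∈ U := ⟨hv, h, by linarith [hvx 0, hvx 1, hvx 2]⟩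
        simp [hE] at this
  · obtain ⟨u, hu, hmin⟩ := Set.exists_min_image U lexKey hUfin hne
    refine ⟨u, fun i => (hu.2.1 i).le, hu.2.2, ?_, ?_⟩
    · have : reducedPoints L ∩ Set.Ici u = ∅ := by
        rw [Set.eq_empty_iff_forall_notMem]
        rintro z ⟨hz, hzu⟩
        refine hz.2 u hu.1 (Or.inl ?_) hzu
        linarith [hu.2.1 0, hu.2.1 1, hu.2.1 2]
      rw [this, measure_empty]
    · intro x hx hx1
      obtain ⟨v, hv, hv0, hvx⟩ := exists_le_of_mem_facet hfin hcov hx hx1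
      by_cases h : ∃ i, v i ≤ 0
      · obtain ⟨i, hi⟩ := h
        exact Or.inr ⟨i, v, hv, Or.inl hv0, hvx, hi⟩
      · push Not at h
        have hvU : v ∈ U := ⟨hv, h, by linarith [hvx 0, hvx 1, hvx 2]⟩
        by_cases hux : u ≤ x
        · exact Or.inl hux
        · right
          -- Two positive vectors: their difference is positive for the order and lies below `x`.
          obtain ⟨i, hi⟩ : ∃ i, x i < u i := by
            by_contra hcon
            push Not at hcon
            exact hux hcon
          refine ⟨i, v - u, L.sub_mem hv hu.1, lexPos_sub_of_lexKey_le (hmin v hvU) ?_, ?_, ?_⟩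
          · rintro rfl
            exact hux hvx
          · intro j
            have := hvx j
            have := hu.2.1 j
            simp only [Pi.sub_apply]
            linarith
          · have := hvx i
            simp only [Pi.sub_apply]
            linarith

end Combinatorics

/-! ### Volumes -/

theorem measurePreserving_of_eq_mulVec_add {f : (Fin 3 → ℝ) → Fin 3 → ℝ}
    (M : Matrix (Fin 3) (Fin 3) ℝ) (hM : |M.det| = 1) (c : Fin 3 → ℝ)
    (hf : ∀ w, f w = M.mulVec w + c) : MeasurePreserving f volume volume := by
  have hd : M.det ≠ 0 := by
    intro h; simp [h] at hM
  have h1 : MeasurePreserving (fun w => M.mulVec w) (volume : Measure (Fin 3 → ℝ)) volume := by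
    refine ⟨(Continuous.matrix_mulVec continuous_const continuous_id).measurable, ?_⟩
    have := Real.map_matrix_volume_pi_eq_smul_volume_pi hd
    rw [abs_inv, hM, inv_one, ENNReal.ofReal_one, one_smul] at this
    exact this
  rw [funext hf]
  exact (measurePreserving_add_right volume c).comp h1

/-- A region of height `y ≤ c + w` over a triangle in the `(c, a)`-plane. -/
def wedge (s w : ℝ) : Set (Fin 3 → ℝ) :=
  {q | 0 ≤ q 0 ∧ q 0 ≤ q 1 ∧ q 1 ≤ s - 2 * q 0 ∧ 0 ≤ q 2 ∧ q 2 ≤ q 0 + w}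

theorem measurableSet_wedge (s w : ℝ) : MeasurableSet (wedge s w) := by
  unfold wedge
  measurability

theorem volume_wedge_le {s w : ℝ} (hs : 0 ≤ s) (hw : 0 ≤ w) :
    volume (wedge s w) ≤ ENNReal.ofReal (w * s ^ 2 / 6 + s ^ 3 / 54) := by
  have hmp := (volume_preserving_piFinSuccAbove (fun _ : Fin 3 => ℝ) 0).symm
  rw [← hmp.measure_preimage (measurableSet_wedge s w).nullMeasurableSet, Measure.volume_eq_prod,
    Measure.prod_apply (hmp.measurable (measurableSet_wedge s w))]
  have hslice : ∀ c : ℝ, volume (Prod.mk c ⁻¹' ((MeasurableEquiv.piFinSuccAbove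
      (fun _ : Fin 3 => ℝ) 0).symm ⁻¹' wedge s w)) ≤
      (Set.Icc 0 (s / 3)).indicator (fun c => ENNReal.ofReal ((s - 3 * c) * (c + w))) c := by
    intro c
    by_cases hc : c ∈ Set.Icc 0 (s / 3)
    · rw [Set.indicator_of_mem hc]
      have hsub : (Prod.mk c ⁻¹' ((MeasurableEquiv.piFinSuccAbove
          (fun _ : Fin 3 => ℝ) 0).symm ⁻¹' wedge s w)) ⊆ Set.Icc ![c, 0] ![s - 2 * c, c + w] := by
        intro p hp
        simp [wedge, MeasurableEquiv.piFinSuccAbove, Fin.insertNthEquiv] at hp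
        obtain ⟨h0, h1, h2, h3, h4⟩ := hp
        change 0 ≤ p 1 at h3
        change p 1 ≤ c + w at h4
        constructor <;> intro i <;> fin_cases i <;> simp_all
      refine (measure_mono hsub).trans ?_
      rw [Real.volume_Icc_pi]
      simp only [Fin.prod_univ_two, Matrix.cons_val_zero, Matrix.cons_val_one, sub_zero]
      rw [← ENNReal.ofReal_mul (by linarith [hc.2])]
      exact le_of_eq (by ring_nf)
    · rw [Set.indicator_of_notMem hc]
      have : (Prod.mk c ⁻¹' ((MeasurableEquiv.piFinSuccAbove
          (fun _ : Fin 3 => ℝ) 0).symm ⁻¹' wedge s w)) = ∅ := by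
        rw [Set.eq_empty_iff_forall_notMem]
        intro p hp
        simp [wedge, MeasurableEquiv.piFinSuccAbove, Fin.insertNthEquiv] at hp
        exact hc ⟨by linarith, by linarith⟩
      rw [this, measure_empty]
  refine (lintegral_mono hslice).trans ?_
  rw [lintegral_indicator measurableSet_Icc, ← ofReal_integral_eq_lintegral_ofReal]
  · apply ENNReal.ofReal_le_ofReal
    rw [integral_Icc_eq_integral_Ioc, ← intervalIntegral.integral_of_le (by positivity)]
    have : ∀ c : ℝ, (s - 3 * c) * (c + w) = s * w + (s - 3 * w) * c - 3 * c ^ 2 := by intro c; ring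
    simp_rw [this]
    have hint : ∀ f : ℝ → ℝ, Continuous f → IntervalIntegrable f volume 0 (s / 3) :=
      fun f hf => hf.intervalIntegrable _ _
    rw [intervalIntegral.integral_sub (hint _ (by fun_prop)) (hint _ (by fun_prop)),
      intervalIntegral.integral_add (hint _ (by fun_prop)) (hint _ (by fun_prop)),
      intervalIntegral.integral_const, intervalIntegral.integral_const_mul,
      intervalIntegral.integral_const_mul, integral_id, integral_pow, smul_eq_mul]
    apply le_of_eq
    norm_num
    ring
  · exact (Continuous.integrableOn_Icc (by fun_prop))
  · rw [Filter.EventuallyLE, ae_restrict_iff' measurableSet_Icc]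
    refine Filter.Eventually.of_forall fun c hc => ?_
    exact mul_nonneg (by linarith [hc.2]) (by linarith [hc.1])

theorem measurableSet_cornerSimplex : MeasurableSet cornerSimplex := by
  unfold cornerSimplex
  measurability

theorem le_volume_cornerSimplex_inter_Ici {u : Fin 3 → ℝ} (hu : ∀ i, 0 ≤ u i)
    (hu1 : u 0 + u 1 + u 2 ≤ 1) :
    ENNReal.ofReal ((1 - (u 0 + u 1 + u 2)) ^ 3 / 6) ≤ volume (cornerSimplex ∩ Set.Ici u) := by
  set s := 1 - (u 0 + u 1 + u 2) with hs
  have hs0 : 0 ≤ s := by linarith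
  have hmeas : MeasurableSet (cornerSimplex ∩ Set.Ici u) :=
    measurableSet_cornerSimplex.inter measurableSet_Ici
  set D : (Fin 3 → ℝ) → (Fin 3 → ℝ) :=
    fun w => ![w 0 + u 0, w 1 - w 0 + u 1, w 2 - w 1 + u 2] with hD
  have hDmp : MeasurePreserving D volume volume := by
    refine measurePreserving_of_eq_mulVec_add !![1, 0, 0; -1, 1, 0; 0, -1, 1]
      (by simp [Matrix.det_fin_three]) u fun w => ?_
    ext i
    fin_cases i <;> simp [hD, Matrix.vecHead, Matrix.vecTail] <;> ring
  have hmp : ∀ σ : Equiv.Perm (Fin 3), MeasurePreserving (fun w : Fin 3 → ℝ => D (w ∘ σ))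
      volume volume := fun σ =>
    hDmp.comp (volume_measurePreserving_piCongrLeft (fun _ : Fin 3 => ℝ) σ).symm
  -- Sorting the coordinates of a cube of side `s`, and taking consecutive differences.
  have hcube : Set.Icc (0 : Fin 3 → ℝ) (fun _ => s) ⊆
      ⋃ σ : Equiv.Perm (Fin 3),
        (fun w : Fin 3 → ℝ => D (w ∘ σ)) ⁻¹' (cornerSimplex ∩ Set.Ici u) := by
    intro w hw
    have hmono := Tuple.monotone_sort w
    refine Set.mem_iUnion.2 ⟨Tuple.sort w, ?_⟩
    have h01 := hmono (show (0 : Fin 3) ≤ 1 by decide)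
    have h12 := hmono (show (1 : Fin 3) ≤ 2 by decide)
    have h0 := hw.1 (Tuple.sort w 0)
    have h2 := hw.2 (Tuple.sort w 2)
    simp only [Function.comp_apply, Pi.zero_apply] at h01 h12 h0 h2
    have hge : u ≤ D (w ∘ Tuple.sort w) := by
      intro i
      fin_cases i <;> simp [hD] <;> linarith
    refine ⟨⟨fun i => (hu i).trans (hge i), ?_⟩, hge⟩
    simp [hD]
    linarith
  have h1 := (measure_mono hcube).trans (measure_iUnion_le (μ := volume) _)
  rw [Real.volume_Icc_pi, tsum_fintype] at h1
  simp_rw [(hmp _).measure_preimage hmeas.nullMeasurableSet] at h1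
  simp only [Pi.zero_apply, sub_zero, Finset.prod_const, Finset.card_univ, Fintype.card_fin,
    Finset.sum_const, Fintype.card_perm, nsmul_eq_mul] at h1
  rw [← ENNReal.ofReal_pow hs0] at h1
  rw [ENNReal.ofReal_div_of_pos (by norm_num)]
  refine ENNReal.div_le_of_le_mul ?_
  rw [mul_comm]
  rwa [show ENNReal.ofReal 6 = ((Nat.factorial 3 : ℕ) : ENNReal) by norm_num [Nat.factorial]]

/-! ### Columns over the facet -/

/-- The point of the facet `∑ xᵢ = 1` with first two coordinates `w 0` and `w 1`. -/
def facetPoint (w : Fin 3 → ℝ) : Fin 3 → ℝ := ![w 0, w 1, 1 - w 0 - w 1]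

/-- The point at height `w 2` of the column that joins a facet point to the `i`-th coordinate
plane in the direction of the `i`-th axis. -/
def columnPoint (i : Fin 3) (w : Fin 3 → ℝ) : Fin 3 → ℝ :=
  Function.update (facetPoint w) i (w 2)

/-- The facet points `x ≥ u`, together with a height between zero and the smallest coordinate of
`x`. In direction `i` these parametrise, through `columnPoint i`, points whose smallest coordinate
is the `i`-th; for `u = 0` they are all such points of the corner simplex. -/
def facetPrism (u : Fin 3 → ℝ) : Set (Fin 3 → ℝ) :=
  {w | 0 ≤ w 2 ∧ (∀ i, w 2 ≤ facetPoint w i) ∧ u ≤ facetPoint w}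

theorem facetPoint_sum (w : Fin 3 → ℝ) :
    facetPoint w 0 + facetPoint w 1 + facetPoint w 2 = 1 := by
  simp [facetPoint]

theorem measurable_facetPoint : Measurable facetPoint := by
  refine measurable_pi_iff.2 fun i => ?_
  fin_cases i <;> simp [facetPoint] <;> fun_prop

theorem measurePreserving_columnPoint (i : Fin 3) :
    MeasurePreserving (columnPoint i) volume volume := by
  fin_cases i
  · refine measurePreserving_of_eq_mulVec_add !![0, 0, 1; 0, 1, 0; -1, -1, 0]
      (by simp [Matrix.det_fin_three]) ![0, 0, 1] fun w => ?_
    ext j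
    fin_cases j <;> simp [columnPoint, facetPoint, Matrix.vecHead, Matrix.vecTail]
    ring
  · refine measurePreserving_of_eq_mulVec_add !![1, 0, 0; 0, 0, 1; -1, -1, 0]
      (by simp [Matrix.det_fin_three]) ![0, 0, 1] fun w => ?_
    ext j
    fin_cases j <;> simp [columnPoint, facetPoint, Matrix.vecHead, Matrix.vecTail]
    ring
  · refine measurePreserving_of_eq_mulVec_add 1 (by simp) 0 fun w => ?_
    ext j
    fin_cases j <;> simp [columnPoint, facetPoint]

theorem measurableSet_facetPrism (u : Fin 3 → ℝ) : MeasurableSet (facetPrism u) := by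
  refine (measurableSet_le measurable_const (measurable_pi_apply 2)).inter
    (MeasurableSet.inter (measurableSet_setOfPred.2 ?_) (measurable_facetPoint measurableSet_Ici))
  exact Measurable.forall fun i => measurableSet_setOfPred.1 <|
    measurableSet_le (measurable_pi_apply 2) ((measurable_pi_apply i).comp measurable_facetPoint)

/-- The prism is cut into three wedges, according to the coordinate at which `x - u` is smallest;
in the `j`-th wedge the height is bounded by `x j` alone. -/
theorem volume_facetPrism_le {u : Fin 3 → ℝ} (hu : ∀ i, 0 ≤ u i) {s : ℝ}
    (hs : u 0 + u 1 + u 2 = 1 - s) (hs0 : 0 ≤ s) :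
    volume (facetPrism u) ≤ ENNReal.ofReal ((1 - s) * s ^ 2 / 6 + s ^ 3 / 18) := by
  set ρ : Fin 3 → (Fin 3 → ℝ) → Fin 3 → ℝ :=
    ![fun w => ![w 0 - u 0, w 1 - u 1, w 2], fun w => ![w 1 - u 1, w 0 - u 0, w 2],
      fun w => ![1 - w 0 - w 1 - u 2, w 0 - u 0, w 2]] with hρ
  have hmp : ∀ j, MeasurePreserving (ρ j) volume volume := by
    intro j
    fin_cases j
    · refine measurePreserving_of_eq_mulVec_add 1 (by simp) ![-u 0, -u 1, 0] fun w => ?_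
      ext j
      fin_cases j <;> simp [hρ] <;> ring
    · refine measurePreserving_of_eq_mulVec_add !![0, 1, 0; 1, 0, 0; 0, 0, 1]
        (by simp [Matrix.det_fin_three]) ![-u 1, -u 0, 0] fun w => ?_
      ext j
      fin_cases j <;> simp [hρ, Matrix.vecHead, Matrix.vecTail] <;> ring
    · refine measurePreserving_of_eq_mulVec_add !![-1, -1, 0; 1, 0, 0; 0, 0, 1]
        (by simp [Matrix.det_fin_three]) ![1 - u 2, -u 0, 0] fun w => ?_
      ext j
      fin_cases j <;> simp [hρ, Matrix.vecHead, Matrix.vecTail] <;> ring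
  have hsub : facetPrism u ⊆ ⋃ j, ρ j ⁻¹' wedge s (u j) := by
    rintro w ⟨h0, h1, h2⟩
    have a0 := h1 0
    have a1 := h1 1
    have a2 := h1 2
    have b0 := h2 0
    have b1 := h2 1
    have b2 := h2 2
    simp [facetPoint] at a0 a1 a2 b0 b1 b2
    rw [Set.mem_iUnion]
    by_cases c01 : w 0 - u 0 ≤ w 1 - u 1
    · by_cases c02 : w 0 - u 0 ≤ 1 - w 0 - w 1 - u 2
      · refine ⟨0, ?_⟩
        simp [wedge, hρ]
        refine ⟨?_, ?_, ?_, ?_, ?_⟩ <;> linarith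
      · refine ⟨2, ?_⟩
        simp [wedge, hρ]
        refine ⟨?_, ?_, ?_, ?_, ?_⟩ <;> linarith
    · by_cases c12 : w 1 - u 1 ≤ 1 - w 0 - w 1 - u 2
      · refine ⟨1, ?_⟩
        simp [wedge, hρ]
        refine ⟨?_, ?_, ?_, ?_, ?_⟩ <;> linarith
      · refine ⟨2, ?_⟩
        simp [wedge, hρ]
        refine ⟨?_, ?_, ?_, ?_, ?_⟩ <;> linarith
  calc volume (facetPrism u) ≤ ∑ j, volume (ρ j ⁻¹' wedge s (u j)) :=
        (measure_mono hsub).trans ((measure_iUnion_le _).trans (by rw [tsum_fintype]))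
    _ = ∑ j, volume (wedge s (u j)) := by
        simp_rw [fun j => (hmp j).measure_preimage (measurableSet_wedge s (u j)).nullMeasurableSet]
    _ ≤ ∑ j, ENNReal.ofReal (u j * s ^ 2 / 6 + s ^ 3 / 54) :=
        Finset.sum_le_sum fun j _ => volume_wedge_le hs0 (hu j)
    _ = ENNReal.ofReal ((1 - s) * s ^ 2 / 6 + s ^ 3 / 18) := by
        rw [← ENNReal.ofReal_sum_of_nonneg fun j _ => by have := hu j; positivity,
          Fin.sum_univ_three, ← hs]
        ring_nf

theorem columnPoint_preimage_subset {i : Fin 3} {w : Fin 3 → ℝ}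
    (h : columnPoint i w ∈ cornerSimplex) (hmin : ∀ j, columnPoint i w i ≤ columnPoint i w j) :
    w ∈ facetPrism 0 := by
  obtain ⟨h0, h1⟩ := h
  have hi : 0 ≤ w 2 := by simpa [columnPoint] using h0 i
  have key : ∀ j, w 2 ≤ facetPoint w j := by
    have a0 := hmin 0
    have a1 := hmin 1
    have a2 := hmin 2
    intro j
    fin_cases i <;> fin_cases j <;> simp_all [columnPoint, facetPoint] <;> linarith
  exact ⟨hi, key, fun j => hi.trans (key j)⟩

/-- A measurable part of the corner simplex is accounted for by its traces on the prism, one for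
each coordinate that may be the smallest. -/
theorem volume_le_sum_columnPoint {A : Set (Fin 3 → ℝ)} (hA : MeasurableSet A)
    (hAS : A ⊆ cornerSimplex) :
    volume A ≤ ∑ i, volume (facetPrism 0 ∩ columnPoint i ⁻¹' A) := by
  set M : Fin 3 → Set (Fin 3 → ℝ) := fun i => A ∩ {z | ∀ j, z i ≤ z j} with hM
  have hMm : ∀ i, MeasurableSet (M i) := by
    intro i
    exact hA.inter <| measurableSet_setOfPred.2 <| Measurable.forall fun j =>
      measurableSet_setOfPred.1 <| measurableSet_le (measurable_pi_apply i) (measurable_pi_apply j)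
  have hsub : A ⊆ ⋃ i, M i := by
    intro z hz
    obtain ⟨i, hi⟩ := Finite.exists_min z
    exact Set.mem_iUnion.2 ⟨i, hz, hi⟩
  calc volume A ≤ ∑ i, volume (M i) :=
        (measure_mono hsub).trans ((measure_iUnion_le _).trans (by rw [tsum_fintype]))
    _ = ∑ i, volume (columnPoint i ⁻¹' M i) := by
        simp_rw [fun i =>
          (measurePreserving_columnPoint i).measure_preimage (hMm i).nullMeasurableSet]
    _ ≤ ∑ i, volume (facetPrism 0 ∩ columnPoint i ⁻¹' A) :=
        Finset.sum_le_sum fun i _ => measure_mono fun w hw =>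
        ⟨columnPoint_preimage_subset (hAS hw.1) hw.2, hw.1⟩

/-- If `A` misses the cone above `u`, and over each facet point not above `u` it misses one of the
three columns, then `A` and the part of the simplex above `u` together are at most two copies of
the full prism and one of the prism over `u`. -/
theorem volume_add_le_of_forall_column {A : Set (Fin 3 → ℝ)} (hA : MeasurableSet A)
    (hAS : A ⊆ cornerSimplex) {u : Fin 3 → ℝ} (hAu : Disjoint A (Set.Ici u))
    (hcol : ∀ x : Fin 3 → ℝ, (∀ i, 0 ≤ x i) → x 0 + x 1 + x 2 = 1 →
      u ≤ x ∨ ∃ i, ∀ y, 0 ≤ y → Function.update x i y ∉ A) :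
    volume A + volume (cornerSimplex ∩ Set.Ici u) ≤
      2 * volume (facetPrism 0) + volume (facetPrism u) := by
  set C : Set (Fin 3 → ℝ) := cornerSimplex ∩ Set.Ici u with hC
  have hCm : MeasurableSet C := measurableSet_cornerSimplex.inter measurableSet_Ici
  set T : Fin 3 → Set (Fin 3 → ℝ) → Set (Fin 3 → ℝ) :=
    fun i X => facetPrism 0 ∩ columnPoint i ⁻¹' X with hT
  have hTm : ∀ i X, MeasurableSet X → MeasurableSet (T i X) := fun i X hX =>
    (measurableSet_facetPrism 0).inter ((measurePreserving_columnPoint i).measurable hX)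
  have hpt : ∀ w, (∑ i, ((T i A).indicator (1 : (Fin 3 → ℝ) → ENNReal) w +
      (T i C).indicator 1 w)) ≤
      2 * (facetPrism 0).indicator 1 w + (facetPrism u).indicator 1 w := by
    intro w
    by_cases hw : w ∈ facetPrism 0
    swap
    · have : ∀ i X, w ∉ T i X := fun i X h => hw h.1
      simp [this]
    -- At most one of the two indicators in each direction.
    have hle1 : ∀ i, (T i A).indicator (1 : (Fin 3 → ℝ) → ENNReal) w +
        (T i C).indicator 1 w ≤ 1 := by
      intro i
      by_cases h : w ∈ T i A
      · have h' : w ∉ T i C := fun h' => Set.disjoint_left.1 hAu h.2 h'.2.2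
        simp [h, h']
      · by_cases h' : w ∈ T i C <;> simp [h, h']
    by_cases hu : u ≤ facetPoint w
    · have hwu : w ∈ facetPrism u := ⟨hw.1, hw.2.1, hu⟩
      rw [Set.indicator_of_mem hw, Set.indicator_of_mem hwu]
      calc _ ≤ ∑ _i : Fin 3, (1 : ENNReal) := Finset.sum_le_sum fun i _ => hle1 i
        _ = _ := by norm_num
    · have hnC : ∀ i, w ∉ T i C := by
        intro i h
        refine hu fun j => (h.2.2 j).trans ?_
        by_cases hij : j = i
        · subst hij
          simpa [columnPoint] using hw.2.1 j
        · simp [columnPoint, hij]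
      obtain ⟨i, hi⟩ := (hcol (facetPoint w) (fun j => hw.1.trans (hw.2.1 j))
        (facetPoint_sum w)).resolve_left hu
      have hnA : w ∉ T i A := fun h => hi _ hw.1 h.2
      have hwu : w ∉ facetPrism u := fun h => hu h.2.2
      rw [Set.indicator_of_mem hw, Set.indicator_of_notMem hwu, add_zero,
        ← Finset.sum_erase (a := i) _ (by simp [hnA, hnC])]
      calc _ ≤ ∑ _j ∈ Finset.univ.erase i, (1 : ENNReal) := Finset.sum_le_sum fun j _ => hle1 j
        _ = _ := by simp
  calc volume A + volume C
      ≤ ∑ i, volume (T i A) + ∑ i, volume (T i C) :=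
        add_le_add (volume_le_sum_columnPoint hA hAS)
          (volume_le_sum_columnPoint hCm Set.inter_subset_left)
    _ = ∫⁻ w, ∑ i, ((T i A).indicator 1 w + (T i C).indicator 1 w) := by
        rw [lintegral_finsetSum, ← Finset.sum_add_distrib]
        · refine Finset.sum_congr rfl fun i _ => ?_
          rw [lintegral_add_left (measurable_one.indicator (hTm i A hA)),
            lintegral_indicator_one (hTm i A hA), lintegral_indicator_one (hTm i C hCm)]
        · exact fun i _ => (measurable_one.indicator (hTm i A hA)).add
            (measurable_one.indicator (hTm i C hCm))
    _ ≤ ∫⁻ w, (2 * (facetPrism 0).indicator 1 w + (facetPrism u).indicator 1 w) :=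
        lintegral_mono hpt
    _ = _ := by
        rw [lintegral_add_right _ (measurable_one.indicator (measurableSet_facetPrism u)),
          lintegral_const_mul _ (measurable_one.indicator (measurableSet_facetPrism 0)),
          lintegral_indicator_one (measurableSet_facetPrism 0),
          lintegral_indicator_one (measurableSet_facetPrism u)]

/-- With `s` the side of the subsimplex `cornerSimplex ∩ Set.Ici u`, the prisms bound the volume of
`A` by the cubic `1 / 9 + s ^ 2 / 6 - 5 * s ^ 3 / 18`, whose maximum `3 / 25` is at `s = 2 / 5`. -/
theorem volume_le_three_div_twentyfive {A : Set (Fin 3 → ℝ)} (hA : MeasurableSet A)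
    (hAS : A ⊆ cornerSimplex) {u : Fin 3 → ℝ} (hu : ∀ i, 0 ≤ u i) (hu1 : u 0 + u 1 + u 2 ≤ 1)
    (hAu : volume (A ∩ Set.Ici u) = 0)
    (hcol : ∀ x : Fin 3 → ℝ, (∀ i, 0 ≤ x i) → x 0 + x 1 + x 2 = 1 →
      u ≤ x ∨ ∃ i, ∀ y, 0 ≤ y → Function.update x i y ∉ A) :
    volume A ≤ ENNReal.ofReal (3 / 25) := by
  obtain ⟨s, hs⟩ : ∃ s, u 0 + u 1 + u 2 = 1 - s := ⟨1 - (u 0 + u 1 + u 2), by ring⟩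
  have hs0 : 0 ≤ s := by linarith
  have hs1 : s ≤ 1 := by linarith [hu 0, hu 1, hu 2]
  have h1 := volume_add_le_of_forall_column (hA.diff (measurableSet_Ici (a := u)))
    (Set.sdiff_subset.trans hAS) Set.disjoint_sdiff_left fun x hx hx1 =>
      (hcol x hx hx1).imp_right fun ⟨i, hi⟩ => ⟨i, fun y hy h => hi y hy h.1⟩
  rw [measure_sdiff_null' hAu] at h1
  have h2 := le_volume_cornerSimplex_inter_Ici hu hu1
  rw [hs, sub_sub_cancel] at h2
  have h3 : volume (facetPrism 0) ≤ ENNReal.ofReal (1 / 18) := by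
    have := volume_facetPrism_le (u := 0) (s := 1) (by simp) (by simp) zero_le_one
    norm_num at this ⊢
    exact this
  have h4 := volume_facetPrism_le hu hs hs0
  have h5 : volume A + ENNReal.ofReal (s ^ 3 / 6) ≤
      ENNReal.ofReal (3 / 25) + ENNReal.ofReal (s ^ 3 / 6) := by
    calc volume A + ENNReal.ofReal (s ^ 3 / 6)
        ≤ 2 * ENNReal.ofReal (1 / 18) + ENNReal.ofReal ((1 - s) * s ^ 2 / 6 + s ^ 3 / 18) :=
          (add_le_add le_rfl h2).trans (h1.trans (add_le_add (mul_le_mul_right h3 2) h4))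
      _ = ENNReal.ofReal (1 / 9 + ((1 - s) * s ^ 2 / 6 + s ^ 3 / 18)) := by
          have : 0 ≤ 1 - s := by linarith
          have hnn : 0 ≤ (1 - s) * s ^ 2 / 6 + s ^ 3 / 18 := by positivity
          rw [ENNReal.ofReal_add (by norm_num) hnn,
            show (2 : ENNReal) = ENNReal.ofReal 2 by norm_num,
            ← ENNReal.ofReal_mul (by norm_num), show (2 : ℝ) * (1 / 18) = 1 / 9 by norm_num]
      _ ≤ ENNReal.ofReal (3 / 25 + s ^ 3 / 6) := by
          apply ENNReal.ofReal_le_ofReal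
          -- The difference is `(5 / 18) (s - 2 / 5)² (s + 1 / 5)`.
          have : 0 ≤ (s - 2 / 5) ^ 2 * (s + 1 / 5) := by positivity
          linarith [this]
      _ = _ := ENNReal.ofReal_add (by norm_num) (by positivity)
  exact (ENNReal.add_le_add_iff_right ENNReal.ofReal_ne_top).1 h5

theorem volume_reducedPoints_le {L : AddSubgroup (Fin 3 → ℝ)}
    (hfin : ∀ R : ℝ, {v | v ∈ L ∧ ∀ i, |v i| ≤ R}.Finite)
    (hcov : ∀ x, ∃ v ∈ L, x - v ∈ cornerSimplex) (hm : MeasurableSet (reducedPoints L)) :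
    volume (reducedPoints L) ≤ ENNReal.ofReal (3 / 25) := by
  obtain ⟨u, hu, hu1, hnull, hcol⟩ := exists_centre hfin hcov
  refine volume_le_three_div_twentyfive hm (fun z hz => hz.1) hu hu1 hnull fun x hx hx1 => ?_
  refine (hcol x hx hx1).imp_right fun ⟨i, v, hv, hpos, hvx, hvi⟩ => ⟨i, fun y hy h => ?_⟩
  refine h.2 v hv hpos fun j => ?_
  by_cases hj : j = i
  · subst hj
    simpa using hvi.trans hy
  · simpa [hj] using hvx j

theorem measurableSet_reducedPoints {L : AddSubgroup (Fin 3 → ℝ)}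
    (hL : (L : Set (Fin 3 → ℝ)).Countable) : MeasurableSet (reducedPoints L) := by
  have : reducedPoints L = cornerSimplex \ ⋃ v ∈ {v | v ∈ (L : Set (Fin 3 → ℝ)) ∧ LexPos v},
      Set.Ici v := by
    ext z
    simp [reducedPoints]
  rw [this]
  exact measurableSet_cornerSimplex.diff
    (MeasurableSet.biUnion (hL.mono fun v hv => hv.1) fun v _ => measurableSet_Ici)

/-! ### Lattices in Euclidean space -/

/-- A measurable set that meets every class modulo a lattice has at least the volume of a
fundamental domain. -/
theorem covolume_le_measureReal {E : Type*} [NormedAddCommGroup E] [NormedSpace ℝ E]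
    [FiniteDimensional ℝ E] [MeasurableSpace E] [BorelSpace E] (μ : Measure E)
    [μ.IsAddHaarMeasure] (Λ : Submodule ℤ E) [DiscreteTopology Λ] [IsZLattice ℝ Λ] {B : Set E}
    (hB : μ B ≠ ⊤) (hcov : ∀ x, ∃ v ∈ Λ, x - v ∈ B) :
    ZLattice.covolume Λ μ ≤ μ.real B := by
  set b := Module.Free.chooseBasis ℤ Λ
  have hF := ZLattice.isAddFundamentalDomain b μ
  rw [ZLattice.covolume_eq_measure_fundamentalDomain Λ μ hF]
  refine ENNReal.toReal_mono hB ?_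
  have : Countable Λ := inferInstance
  have : MeasurableVAdd Λ E := (inferInstance : MeasurableVAdd Λ.toAddSubgroup E)
  have : VAddInvariantMeasure Λ E μ :=
    (inferInstance : VAddInvariantMeasure Λ.toAddSubgroup E μ)
  rw [hF.measure_eq_tsum B]
  refine le_trans (measure_mono ?_) (measure_iUnion_le _)
  intro x hx
  obtain ⟨v, hv, hxv⟩ := hcov x
  refine Set.mem_iUnion.2 ⟨⟨v, hv⟩, ?_, hx⟩
  rw [Set.mem_vadd_set]
  refine ⟨x - v, hxv, ?_⟩
  change v + (x - v) = x
  abel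

theorem finite_inter_of_isCompact {E : Type*} [NormedAddCommGroup E] [NormedSpace ℝ E]
    [FiniteDimensional ℝ E] (Λ : Submodule ℤ E) [DiscreteTopology Λ] {K : Set E}
    (hK : IsCompact K) : (K ∩ (Λ : Set E)).Finite := by
  have hd : DiscreteTopology Λ.toAddSubgroup := inferInstanceAs (DiscreteTopology Λ)
  have : IsClosed (Λ.toAddSubgroup : Set E) := AddSubgroup.isClosed_of_discrete
  exact Metric.finite_isBounded_inter_isClosed (s := (Λ : Set E))
    (isDiscrete_iff_discreteTopology.2 ‹_›) hK.isBounded this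

/-- There are linear coordinates in which a tetrahedron is a translate of the corner simplex. -/
theorem exists_coordinates (p : Fin 4 → EuclideanSpace ℝ (Fin 3)) (hp : AffineIndependent ℝ p) :
    ∃ φ : (Fin 3 → ℝ) ≃L[ℝ] EuclideanSpace ℝ (Fin 3),
      convexHull ℝ (Set.range p) = (fun z => p 0 + φ z) '' cornerSimplex := by
  have hli : LinearIndependent ℝ (fun i : Fin 3 => p i.succ -ᵥ p 0) := by
    have := (affineIndependent_iff_linearIndependent_vsub ℝ p 0).1 hp
    exact this.comp (fun i : Fin 3 => (⟨i.succ, Fin.succ_ne_zero i⟩ : {x // x ≠ (0 : Fin 4)}))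
      fun i j h => Fin.succ_injective _ (congrArg Subtype.val h)
  set b := basisOfLinearIndependentOfCardEqFinrank hli (by simp) with hb
  refine ⟨b.equivFun.symm.toContinuousLinearEquiv, ?_⟩
  have hφ : ∀ z : Fin 3 → ℝ, b.equivFun.symm.toContinuousLinearEquiv z =
      z 0 • (p 1 - p 0) + z 1 • (p 2 - p 0) + z 2 • (p 3 - p 0) := by
    intro z
    simp [hb, Module.Basis.equivFun_symm_apply, Fin.sum_univ_three]
  apply Set.Subset.antisymm
  · refine convexHull_min ?_ ?_
    · rintro _ ⟨i, rfl⟩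
      refine ⟨fun j => if i = j.succ then 1 else 0, ⟨fun j => ?_, ?_⟩, ?_⟩
      · dsimp only
        split_ifs <;> norm_num
      · fin_cases i <;> simp [Fin.ext_iff]
      · simp only [hφ]
        fin_cases i <;> simp [Fin.ext_iff]
    · rintro _ ⟨z, ⟨hz, hz1⟩, rfl⟩ _ ⟨w, ⟨hw, hw1⟩, rfl⟩ a c ha hc hac
      refine ⟨a • z + c • w, ⟨fun i => ?_, ?_⟩, ?_⟩
      · have h1 := mul_nonneg ha (hz i)
        have h2 := mul_nonneg hc (hw i)
        simpa using add_nonneg h1 h2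
      · simp only [Pi.add_apply, Pi.smul_apply, smul_eq_mul]
        nlinarith [mul_le_mul_of_nonneg_left hz1 ha, mul_le_mul_of_nonneg_left hw1 hc]
      · simp only [map_add, map_smul, smul_add]
        rw [add_add_add_comm, ← add_smul, hac, one_smul]
  · rintro _ ⟨z, ⟨hz, hz1⟩, rfl⟩
    have hmem := (convex_convexHull ℝ (Set.range p)).sum_mem
      (t := Finset.univ) (w := ![1 - (z 0 + z 1 + z 2), z 0, z 1, z 2]) (z := p)
      (fun i _ => by fin_cases i <;> simp <;> first | linarith | exact hz _)
      (by simp [Fin.sum_univ_four]; ring)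
      (fun i _ => subset_convexHull ℝ _ ⟨i, rfl⟩)
    convert hmem using 1
    simp only [hφ, Fin.sum_univ_four]
    simp
    module

/-- A linear isomorphism scales volume by a constant factor. -/
theorem exists_measureReal_image_eq_mul
    (φ : (Fin 3 → ℝ) ≃L[ℝ] EuclideanSpace ℝ (Fin 3)) :
    ∃ c : ℝ, 0 ≤ c ∧ ∀ A : Set (Fin 3 → ℝ), volume.real (φ '' A) = c * volume.real A := by
  set ν : Measure (Fin 3 → ℝ) := volume.map φ.symm
  have hν : ν.IsAddHaarMeasure := φ.symm.isAddHaarMeasure_map volume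
  refine ⟨Measure.addHaarScalarFactor ν volume, NNReal.coe_nonneg _, fun A => ?_⟩
  have h1 : volume (φ '' A) = ν A := by
    have := φ.symm.toHomeomorph.toMeasurableEquiv.map_apply (μ := volume) A
    refine Eq.trans ?_ this.symm
    congr 1
    exact φ.toEquiv.image_eq_preimage_symm A
  have h2 : ν A = Measure.addHaarScalarFactor ν volume • volume A := by
    conv_lhs => rw [Measure.isAddLeftInvariant_eq_smul ν volume]
    rfl
  rw [measureReal_def, h1, h2, measureReal_def]
  simp [ENNReal.smul_def]

theorem cornerSimplex_subset_Icc : cornerSimplex ⊆ Set.Icc 0 1 := by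
  rintro z ⟨h0, h1⟩
  refine ⟨h0, fun i => ?_⟩
  have := h0 0
  have := h0 1
  have := h0 2
  fin_cases i <;> simp <;> linarith

/-- The density bound for one lattice covering, in coordinates. -/
theorem le_coveringDensity_of_isLatticeCovering
    (φ : (Fin 3 → ℝ) ≃L[ℝ] EuclideanSpace ℝ (Fin 3)) (a : EuclideanSpace ℝ (Fin 3))
    (Λ : Submodule ℤ (EuclideanSpace ℝ (Fin 3))) [DiscreteTopology Λ] [IsZLattice ℝ Λ]
    (h : IsLatticeCovering ((fun z => a + φ z) '' cornerSimplex) Λ) :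
    25 / 18 ≤ coveringDensity ((fun z => a + φ z) '' cornerSimplex) Λ := by
  set L : AddSubgroup (Fin 3 → ℝ) :=
    Λ.toAddSubgroup.comap (φ : (Fin 3 → ℝ) →ₗ[ℝ] EuclideanSpace ℝ (Fin 3)).toAddMonoidHom
  have hmem : ∀ v, v ∈ L ↔ φ v ∈ Λ := fun v => Iff.rfl
  have hfin : ∀ R : ℝ, {v | v ∈ L ∧ ∀ i, |v i| ≤ R}.Finite := by
    intro R
    have hK : IsCompact (φ '' Set.Icc (fun _ => -R) (fun _ => R)) :=
      isCompact_Icc.image φ.continuous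
    refine Set.Finite.subset
      ((finite_inter_of_isCompact Λ hK).preimage φ.injective.injOn) ?_
    rintro v ⟨hv, hR⟩
    exact ⟨⟨v, ⟨fun i => (abs_le.1 (hR i)).1, fun i => (abs_le.1 (hR i)).2⟩, rfl⟩, hv⟩
  have hcov : ∀ x, ∃ v ∈ L, x - v ∈ cornerSimplex := by
    intro x
    have hx : a + φ x ∈ ⋃ v ∈ Λ, (fun x => x + v) '' ((fun z => a + φ z) '' cornerSimplex) := by
      rw [h]
      trivial
    obtain ⟨v, hv, _, ⟨z, hz, rfl⟩, hzx⟩ := Set.mem_iUnion₂.1 hx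
    have hzv : z + φ.symm v = x := by
      apply φ.injective
      have : a + (φ z + v) = a + φ x := by rw [← add_assoc]; exact hzx
      simpa using add_left_cancel this
    refine ⟨φ.symm v, by simpa [hmem] using hv, ?_⟩
    rwa [← hzv, add_sub_cancel_right]
  have hcount : (L : Set (Fin 3 → ℝ)).Countable := by
    have : Countable Λ := inferInstance
    exact (Set.to_countable (Λ : Set (EuclideanSpace ℝ (Fin 3)))).preimage φ.injective
  have hvol := volume_reducedPoints_le hfin hcov (measurableSet_reducedPoints hcount)
  obtain ⟨c, hc, hφ⟩ := exists_measureReal_image_eq_mul φ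
  have hB : volume.real (reducedPoints L) ≤ 3 / 25 :=
    ENNReal.toReal_le_of_le_ofReal (by norm_num) hvol
  have hcovol : ZLattice.covolume Λ ≤ volume.real (φ '' reducedPoints L) := by
    refine covolume_le_measureReal volume Λ ?_ fun x => ?_
    · have hbdd : Bornology.IsBounded (reducedPoints L) :=
        (Metric.isBounded_Icc (0 : Fin 3 → ℝ) 1).subset
          fun z hz => cornerSimplex_subset_Icc hz.1
      exact (φ.lipschitz.isBounded_image hbdd).measure_lt_top.ne
    · obtain ⟨v, hv, hxv⟩ := exists_sub_mem_reducedPoints hfin hcov (φ.symm x)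
      exact ⟨φ v, hv, _, hxv, by simp⟩
  have hS : (1 : ℝ) / 6 ≤ volume.real cornerSimplex := by
    have h0 := le_volume_cornerSimplex_inter_Ici (u := 0) (by simp) (by simp)
    have hfinS : volume cornerSimplex ≠ ⊤ :=
      ((Metric.isBounded_Icc (0 : Fin 3 → ℝ) 1).subset
        cornerSimplex_subset_Icc).measure_lt_top.ne
    have h1 := (ENNReal.ofReal_le_iff_le_toReal hfinS).1
      (h0.trans (measure_mono Set.inter_subset_left))
    simpa [measureReal_def] using h1
  have hK : volume.real ((fun z => a + φ z) '' cornerSimplex) = c * volume.real cornerSimplex := by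
    rw [← hφ, ← Set.image_image (fun x => a + x) φ, measureReal_def, measureReal_def,
      Set.image_add_left, measure_preimage_add]
  have hpos := ZLattice.covolume_pos Λ volume
  rw [coveringDensity, le_div_iff₀ hpos, hK]
  rw [hφ] at hcovol
  nlinarith [mul_le_mul_of_nonneg_left hB hc, mul_le_mul_of_nonneg_left hS hc]

/-- Every tetrahedron admits a lattice covering: it contains a parallelepiped. -/
theorem exists_isLatticeCovering
    (φ : (Fin 3 → ℝ) ≃L[ℝ] EuclideanSpace ℝ (Fin 3)) (a : EuclideanSpace ℝ (Fin 3)) :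
    ∃ (Λ : Submodule ℤ (EuclideanSpace ℝ (Fin 3))) (_ : DiscreteTopology Λ),
      IsZLattice ℝ Λ ∧ IsLatticeCovering ((fun z => a + φ z) '' cornerSimplex) Λ := by
  set ψ : (Fin 3 → ℝ) ≃ₗ[ℝ] EuclideanSpace ℝ (Fin 3) :=
    (LinearEquiv.smulOfNeZero ℝ (Fin 3 → ℝ) (1 / 3 : ℝ) (by norm_num)).trans φ.toLinearEquiv
  have hψ : ∀ w, ψ w = φ ((1 / 3 : ℝ) • w) := fun w => rfl
  set b := (Pi.basisFun ℝ (Fin 3)).map ψ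
  refine ⟨Submodule.span ℤ (Set.range b), inferInstance, inferInstance, ?_⟩
  refine Set.eq_univ_of_forall fun x => ?_
  have hr : ∀ i, ψ.symm (ZSpan.fract b (x - a)) i = Int.fract (b.repr (x - a) i) := by
    intro i
    rw [← ZSpan.repr_fract_apply]
    rfl
  have hr0 := fun i => (hr i).symm ▸ Int.fract_nonneg (b.repr (x - a) i)
  have hr1 := fun i => (hr i).symm ▸ (Int.fract_lt_one (b.repr (x - a) i)).le
  refine Set.mem_iUnion₂.2 ⟨ZSpan.floor b (x - a), (ZSpan.floor b (x - a)).2, _,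
    ⟨(1 / 3 : ℝ) • ψ.symm (ZSpan.fract b (x - a)), ⟨fun i => ?_, ?_⟩, rfl⟩, ?_⟩
  · exact mul_nonneg (by norm_num) (hr0 i)
  · simp only [Pi.smul_apply, smul_eq_mul]
    linarith [hr1 0, hr1 1, hr1 2]
  · dsimp only
    rw [← hψ, LinearEquiv.apply_symm_apply, ZSpan.fract_apply]
    abel

theorem theorem1p1 (p : Fin 4 → EuclideanSpace ℝ (Fin 3)) (hp : AffineIndependent ℝ p) :
    (∀ (Λ : Submodule ℤ (EuclideanSpace ℝ (Fin 3))) [DiscreteTopology Λ] [IsZLattice ℝ Λ],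
      IsLatticeCovering (convexHull ℝ (Set.range p)) Λ →
        25 / 18 ≤ coveringDensity (convexHull ℝ (Set.range p)) Λ) ∧
    25 / 18 ≤ latticeCoveringDensity (convexHull ℝ (Set.range p)) := by
  obtain ⟨φ, hφ⟩ := exists_coordinates p hp
  rw [hφ]
  refine ⟨fun Λ _ _ h => le_coveringDensity_of_isLatticeCovering φ (p 0) Λ h, le_csInf ?_ ?_⟩
  · obtain ⟨Λ, hd, hΛ, h⟩ := exists_isLatticeCovering φ (p 0)
    exact ⟨_, Λ, hd, hΛ, h, rfl⟩
  · rintro _ ⟨Λ, hd, hΛ, h, rfl⟩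
    exact le_coveringDensity_of_isLatticeCovering φ (p 0) Λ h
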